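/- Let $d\ge 2$. Let $\mathcal D_d$ be the set of probability densities on $[0,1)^d$ with respect to Lebesgue measure, and let $\|\cdot\|$ be the $L^1$ norm. For $b\ge1$ let $\mathcal H_{1,b}$ be the set of one-dimensional histograms, that is, the convex hull of the densities $b\,\mathbf 1_{[(i-1)/b,\,i/b)}$, $1\le i\le b$. For $k\ge 1$ let the set of Tucker histograms be $$\widetilde{\mathcal H}^k_{d,b}=\Big\{x\mapsto\sum_{S\in[k]^d}W_S\prod_{i=1}^d f_{i,S_i}(x_i)\ :\ W_S\ge 0,\ \sum_{S\in[k]^d}W_S=1,\ f_{i,j}\in\mathcal H_{1,b}\Big\}.$$ **Theorem.** Let $b=b(n)$ and $k=k(n)$ be sequences of positive integers with $b\to\infty$, $k\to\infty$, $b\ge k$ and $$\frac{n}{bk+k^d}\to 0\qquad(n\to\infty).$$ Then there is no sequence of estimators $V_n=V_n(X_1,\dots,X_n)$ with values in $\widetilde{\mathcal H}^{k(n)}_{d,b(n)}$ such that, for every $\varepsilon>0$, $$\sup_{p\in\mathcal D_d}P_p\Big(\|V_n-p\|>3\min_{q\in\widetilde{\mathcal H}^{k(n)}_{d,b(n)}}\|p-q\|+\varepsilon\Big)\longrightarrow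 0\qquad(n\to\infty),$$ where under $P_p$ the points $X_1,\dots,X_n$ are independent with density $p$. -/

import Mathlib

open MeasureTheory Filter Topology

noncomputable section

/-- The cube `[0,1)^d`. -/
def unitCube (d : ℕ) : Set (Fin d → ℝ) :=
  Set.univ.pi fun _ => Set.Ico (0 : ℝ) 1

/-- Probability densities on `[0,1)^d` with respect to Lebesgue measure, as Borel functions on `ℝ^d`
that vanish outside the cube. -/
def cubeDensities (d : ℕ) : Set ((Fin d → ℝ) → ℝ) :=
  {p | Measurable p ∧ (∀ x, 0 ≤ p x) ∧ (∀ x, x ∉ unitCube d → p x = 0) ∧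
    ∫⁻ x, ENNReal.ofReal (p x) = 1}

/-- The measure with Lebesgue density `p`. -/
def densityMeasure {d : ℕ} (p : (Fin d → ℝ) → ℝ) : Measure (Fin d → ℝ) :=
  volume.withDensity fun x => ENNReal.ofReal (p x)

/-- The law of `n` independent samples from the density `p`. -/
def sampleLaw {d : ℕ} (n : ℕ) (p : (Fin d → ℝ) → ℝ) : Measure (Fin n → Fin d → ℝ) :=
  Measure.pi fun _ => densityMeasure p

/-- The `L¹` distance with respect to Lebesgue measure. -/
def l1Dist {d : ℕ} (f g : (Fin d → ℝ) → ℝ) : ℝ :=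
  ∫ x, |f x - g x|

/-- The one-dimensional histogram with all its weight in the bin `[i/b, (i+1)/b)`, for `i < b`
(bins are numbered from `0`). -/
def binDensity (b : ℕ) (i : Fin b) : ℝ → ℝ :=
  Set.indicator (Set.Ico ((i : ℝ) / b) (((i : ℝ) + 1) / b)) fun _ => (b : ℝ)

/-- The one-dimensional histograms on `[0,1)` with `b` bins. -/
def histograms1 (b : ℕ) : Set (ℝ → ℝ) :=
  convexHull ℝ (Set.range (binDensity b))

/-- The Tucker histograms on `[0,1)^d`, with `b` bins per dimension and `k` factors per dimension:
`∑_{S ∈ [k]^d} W_S ∏_i f_{i,S_i}` with `W` a probability tensor of shape `k × ⋯ × k` and the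
`f_{i,j}` one-dimensional histograms; the product is the outer product. -/
def tuckerHistograms (d b k : ℕ) : Set ((Fin d → ℝ) → ℝ) :=
  {h | ∃ W ∈ stdSimplex ℝ (Fin d → Fin k), ∃ f : Fin d → Fin k → ℝ → ℝ,
    (∀ i j, f i j ∈ histograms1 b) ∧
      h = fun x => ∑ S : Fin d → Fin k, W S * ∏ i, f i (S i) (x i)}

/-- The oracle error `min_{q ∈ Q} ‖p - q‖`. It is written as an infimum; for the Tucker histograms
this is attained, as they are the continuous image of a compact set. -/
def oracleError {d : ℕ} (Q : Set ((Fin d → ℝ) → ℝ)) (p : (Fin d → ℝ) → ℝ) : ℝ :=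
  ⨅ q : Q, l1Dist p q.1

end

/-! Let `C` be a family of distinct grid cells all of whose mixtures are Tucker histograms. On these
mixtures the oracle error vanishes, so the factor 3 is immaterial and the estimator must learn a
distribution on `C`; this forces `|C| ≤ 32 (n + 1)` (`card_le_of_estimator`). To see this, take `m =
16 t` pairs of cells and let `p σ` be uniform on the choice of one cell from each pair. Since `p σ ≤
2 p₀`, with `p₀` uniform on all the cells, an event of `p σ`-probability at least `1/2` has
`p₀`-probability at least `2^(-n-1)`. One sample is good only for `σ` in a Hamming ball of radius
`t`, which has at most `64^t` points. Summing over `σ` gives `2^(16t-1) ≤ 2^n 64^t`, so `10 t ≤ n +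
1` (`le_sampleSize_of_estimator`). Two families apply: the slab cells (`b k` of them) and the corner
cells (`k^d`). Together they bound `b k + k^d` by `64 (n + 1)`. -/

noncomputable section

/-! ### Comparison of product measures. -/

section PiMeasure

variable {ι : Type*} [Fintype ι] {α : ι → Type*} [∀ i, MeasurableSpace (α i)]

/-- Arguing with the outer measures that define the products avoids any σ-finiteness. -/
theorem Measure.pi_le_pi {μ ν : ∀ i, Measure (α i)} (h : ∀ i, μ i ≤ ν i) :
    Measure.pi μ ≤ Measure.pi ν := by
  refine Measure.le_iff.2 fun s hs => ?_
  rw [Measure.pi, Measure.pi, toMeasure_apply _ _ hs, toMeasure_apply _ _ hs]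
  refine OuterMeasure.le_boundedBy.2 (fun t => (OuterMeasure.boundedBy_le t).trans ?_) s
  exact Finset.prod_le_prod' fun i _ => h i _

theorem Measure.pi_const_smul (c : ENNReal) (hc : c ≠ ⊤) (ν : ∀ i, Measure (α i))
    [∀ i, IsFiniteMeasure (ν i)] :
    Measure.pi (fun i => c • ν i) = c ^ Fintype.card ι • Measure.pi ν := by
  have := fun i => (ν i).smul_finite hc
  refine Measure.pi_eq fun s _ => ?_
  simp [Measure.pi_pi, Finset.prod_mul_distrib]

end PiMeasure

/-! ### Volume of Hamming balls of radius one sixteenth of the length. -/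

section HammingBall

theorem sum_prod_ite_eq {m : ℕ} (σ : Fin m → Bool) :
    ∑ τ : Fin m → Bool, ∏ i, (if σ i = τ i then 15 else 1) = 16 ^ m := by
  have := Finset.prod_univ_sum (fun _ : Fin m => (Finset.univ : Finset Bool))
    (fun i β => if σ i = β then 15 else 1)
  rw [Fintype.piFinset_univ] at this
  have h : ∀ i, ∑ β : Bool, (if σ i = β then 15 else 1) = 16 := fun i => by
    cases σ i <;> rfl
  rw [← this, Finset.prod_congr rfl fun i _ => h i]
  simp

/-- Chernoff's argument: with weight 15 per agreement, each point of the ball weighs at least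
`15^(15t)`, while the whole cube weighs `16^(16t)`. -/
theorem card_hammingBall_le (t : ℕ) (S : Finset (Fin (16 * t) → Bool)) (σ : Fin (16 * t) → Bool)
    (hS : ∀ τ ∈ S, hammingDist σ τ ≤ t) : S.card ≤ 64 ^ t := by
  have h1 : ∀ τ ∈ S, 15 ^ (15 * t) ≤ ∏ i, (if σ i = τ i then 15 else 1) := fun τ hτ => by
    rw [Finset.prod_ite, Finset.prod_const, Finset.prod_const_one, mul_one]
    refine Nat.pow_le_pow_right (by norm_num) ?_
    have h := Finset.card_filter_add_card_filter_not (s := Finset.univ) (fun i => σ i = τ i)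
    have h' := hS τ hτ
    rw [hammingDist] at h'
    simp only [Finset.card_univ, Fintype.card_fin] at h
    simp only [ne_eq] at h'
    omega
  have h2 : S.card * 15 ^ (15 * t) ≤ 16 ^ (16 * t) :=
    calc S.card * 15 ^ (15 * t) = ∑ τ ∈ S, 15 ^ (15 * t) := by simp
      _ ≤ ∑ τ ∈ S, ∏ i, (if σ i = τ i then 15 else 1) := Finset.sum_le_sum h1
      _ ≤ ∑ τ : Fin (16 * t) → Bool, ∏ i, (if σ i = τ i then 15 else 1) :=
        Finset.sum_le_sum_of_subset (Finset.subset_univ _)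
      _ = _ := sum_prod_ite_eq σ
  have h3 : 16 ^ (16 * t) ≤ 64 ^ t * 15 ^ (15 * t) := by
    rw [pow_mul, pow_mul, ← mul_pow]
    -- The numerical fact is `16^16 ≤ 64 * 15^15`.
    exact Nat.pow_le_pow_left (by norm_num) t
  exact Nat.le_of_mul_le_mul_right (h2.trans h3) (by positivity)

end HammingBall

/-! ### Mixtures of uniform distributions on grid cells. -/

section Cells

variable {d b : ℕ}

/-- The density of the uniform distribution on a cell of the grid with `b` bins per dimension. -/
def cellDensity (c : Fin d → Fin b) (x : Fin d → ℝ) : ℝ :=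
  ∏ i, binDensity b (c i) (x i)

/-- The mixture, with weights `w`, of the uniform distributions on a family of cells. -/
def cellMixture {D : Type*} [Fintype D] (cell : D → Fin d → Fin b) (w : D → ℝ)
    (x : Fin d → ℝ) : ℝ :=
  ∑ a, w a * cellDensity (cell a) x

theorem binDensity_nonneg (i : Fin b) (x : ℝ) : 0 ≤ binDensity b i x :=
  Set.indicator_nonneg (fun _ _ => by positivity) x

theorem measurable_binDensity (i : Fin b) : Measurable (binDensity b i) :=
  measurable_const.indicator measurableSet_Ico

theorem integrable_binDensity (i : Fin b) : Integrable (binDensity b i) := by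
  refine (integrable_indicator_iff measurableSet_Ico).2 (integrableOn_const ?_)
  simp

theorem integral_binDensity (i : Fin b) : ∫ x, binDensity b i x = 1 := by
  have hb : (0 : ℝ) < b := by exact_mod_cast i.pos
  rw [binDensity, integral_indicator measurableSet_Ico, setIntegral_const]
  rw [Measure.real, Real.volume_Ico, ← sub_div, add_sub_cancel_left,
    ENNReal.toReal_ofReal (by positivity)]
  simp [hb.ne']

theorem floor_mul_of_binDensity_ne_zero {i : Fin b} {x : ℝ} (h : binDensity b i x ≠ 0) :
    ⌊x * b⌋ = (i : ℤ) := by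
  have hb : (0 : ℝ) < b := by exact_mod_cast i.pos
  obtain ⟨h1, h2⟩ := Set.mem_of_indicator_ne_zero h
  rw [div_le_iff₀ hb] at h1
  rw [lt_div_iff₀ hb] at h2
  exact Int.floor_eq_iff.2 ⟨by exact_mod_cast h1, by exact_mod_cast h2⟩

theorem mem_Ico_of_binDensity_ne_zero {i : Fin b} {x : ℝ} (h : binDensity b i x ≠ 0) :
    x ∈ Set.Ico (0 : ℝ) 1 := by
  have hb : (0 : ℝ) < b := by exact_mod_cast i.pos
  obtain ⟨h1, h2⟩ := Set.mem_of_indicator_ne_zero h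
  refine ⟨le_trans (by positivity) h1, h2.trans_le ?_⟩
  rw [div_le_one hb]
  exact_mod_cast i.isLt

theorem cellDensity_nonneg (c : Fin d → Fin b) (x : Fin d → ℝ) : 0 ≤ cellDensity c x :=
  Finset.prod_nonneg fun _ _ => binDensity_nonneg _ _

theorem measurable_cellDensity (c : Fin d → Fin b) : Measurable (cellDensity c) :=
  Finset.measurable_prod _ fun i _ => (measurable_binDensity _).comp (measurable_pi_apply i)

theorem integrable_cellDensity (c : Fin d → Fin b) : Integrable (cellDensity c) :=
  Integrable.fintype_prod fun _ => integrable_binDensity _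

theorem integral_cellDensity (c : Fin d → Fin b) : ∫ x, cellDensity c x = 1 := by
  simp [cellDensity, integral_fintype_prod_volume_eq_prod (fun i => binDensity b (c i)),
    integral_binDensity]

theorem eq_of_cellDensity_ne_zero {c c' : Fin d → Fin b} {x : Fin d → ℝ}
    (h : cellDensity c x ≠ 0) (h' : cellDensity c' x ≠ 0) : c = c' := by
  rw [cellDensity, Finset.prod_ne_zero_iff] at h h'
  funext i
  have := (floor_mul_of_binDensity_ne_zero (h i (Finset.mem_univ i))).symm.trans
    (floor_mul_of_binDensity_ne_zero (h' i (Finset.mem_univ i)))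
  exact Fin.ext (by exact_mod_cast this)

variable {D : Type*} [Fintype D] {cell : D → Fin d → Fin b}

theorem measurable_cellMixture (w : D → ℝ) : Measurable (cellMixture cell w) :=
  Finset.measurable_sum _ fun _ _ => (measurable_cellDensity _).const_mul _

theorem integrable_cellMixture (w : D → ℝ) : Integrable (cellMixture cell w) :=
  integrable_finsetSum _ fun _ _ => (integrable_cellDensity _).const_mul _

theorem integral_cellMixture (w : D → ℝ) : ∫ x, cellMixture cell w x = ∑ a, w a := by
  simp only [cellMixture]
  rw [integral_finsetSum _ fun _ _ => (integrable_cellDensity _).const_mul _]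
  simp [integral_const_mul, integral_cellDensity]

theorem cellMixture_mono {w w' : D → ℝ} (h : w ≤ w') (x : Fin d → ℝ) :
    cellMixture cell w x ≤ cellMixture cell w' x :=
  Finset.sum_le_sum fun a _ => mul_le_mul_of_nonneg_right (h a) (cellDensity_nonneg _ _)

theorem cellMixture_smul (c : ℝ) (w : D → ℝ) (x : Fin d → ℝ) :
    cellMixture cell (c • w) x = c * cellMixture cell w x := by
  simp [cellMixture, Finset.mul_sum, mul_assoc]

theorem cellMixture_sub (w w' : D → ℝ) (x : Fin d → ℝ) :
    cellMixture cell (w - w') x = cellMixture cell w x - cellMixture cell w' x := by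
  simp [cellMixture, sub_mul]

theorem cellMixture_nonneg {w : D → ℝ} (h : 0 ≤ w) (x : Fin d → ℝ) :
    0 ≤ cellMixture cell w x :=
  Finset.sum_nonneg fun a _ => mul_nonneg (h a) (cellDensity_nonneg _ _)

theorem cellMixture_mem_cubeDensities {w : D → ℝ} (hw : w ∈ stdSimplex ℝ D) :
    cellMixture cell w ∈ cubeDensities d := by
  refine ⟨measurable_cellMixture w, cellMixture_nonneg hw.1, fun x hx => ?_, ?_⟩
  · refine Finset.sum_eq_zero fun a _ => mul_eq_zero_of_right _ ?_
    by_contra h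
    rw [cellDensity, ← ne_eq, Finset.prod_ne_zero_iff] at h
    exact hx fun i _ => mem_Ico_of_binDensity_ne_zero (h i (Finset.mem_univ i))
  · rw [← ofReal_integral_eq_lintegral_ofReal (integrable_cellMixture w)
      (ae_of_all _ (cellMixture_nonneg hw.1)), integral_cellMixture, hw.2, ENNReal.ofReal_one]

/-- Distinct cells are disjoint, so at most one term is nonzero at each point. This turns `L¹`
distances of mixtures into `ℓ¹` distances of weights. -/
theorem abs_cellMixture (hcell : Function.Injective cell) (w : D → ℝ) (x : Fin d → ℝ) :
    |cellMixture cell w x| = cellMixture cell (fun a => |w a|) x := by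
  classical
  by_cases h : ∃ a, cellDensity (cell a) x ≠ 0
  · obtain ⟨a, ha⟩ := h
    have h0 : ∀ a', a' ≠ a → cellDensity (cell a') x = 0 := fun a' ha' => by
      by_contra h'
      exact ha' (hcell (eq_of_cellDensity_ne_zero h' ha))
    simp only [cellMixture]
    rw [Fintype.sum_eq_single a fun a' ha' => by rw [h0 a' ha', mul_zero],
      Fintype.sum_eq_single a fun a' ha' => by rw [h0 a' ha', mul_zero],
      abs_mul, abs_of_nonneg (cellDensity_nonneg _ _)]
  · push Not at h
    simp [cellMixture, h]

theorem l1Dist_cellMixture (hcell : Function.Injective cell) (w w' : D → ℝ) :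
    l1Dist (cellMixture cell w) (cellMixture cell w') = ∑ a, |w a - w' a| := by
  simp only [l1Dist, ← cellMixture_sub, abs_cellMixture hcell]
  exact integral_cellMixture _

theorem cellMixture_comp {C : Type*} [Fintype C] [DecidableEq C] (cell : C → Fin d → Fin b)
    (φ : D → C) (w : D → ℝ) :
    cellMixture (cell ∘ φ) w = cellMixture cell fun c => ∑ a with φ a = c, w a := by
  funext x
  simp only [cellMixture, Finset.sum_mul, Function.comp]
  rw [← Finset.sum_fiberwise Finset.univ φ]
  refine Finset.sum_congr rfl fun c _ => Finset.sum_congr rfl fun a ha => ?_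
  rw [(Finset.mem_filter.1 ha).2]

theorem sum_fiber_mem_stdSimplex {C : Type*} [Fintype C] [DecidableEq C] (φ : D → C) {w : D → ℝ}
    (hw : w ∈ stdSimplex ℝ D) : (fun c => ∑ a with φ a = c, w a) ∈ stdSimplex ℝ C :=
  ⟨fun _ => Finset.sum_nonneg fun a _ => hw.1 a, by rw [Finset.sum_fiberwise, hw.2]⟩

end Cells

/-! ### The sample size needed to learn mixtures of cells. -/

section LowerBound

variable {d : ℕ}

theorem l1Dist_nonneg (f g : (Fin d → ℝ) → ℝ) : 0 ≤ l1Dist f g :=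
  integral_nonneg fun _ => abs_nonneg _

/-- Integrability matters: the integral of a non-integrable function is 0 by convention. -/
theorem l1Dist_le_add {f p q : (Fin d → ℝ) → ℝ} (hf : Integrable f) (hp : Integrable p)
    (hq : Integrable q) : l1Dist p q ≤ l1Dist f p + l1Dist f q := by
  refine le_trans ?_ (integral_add (hf.sub hp).abs (hf.sub hq).abs).le
  refine integral_mono (hp.sub hq).abs ((hf.sub hp).abs.add (hf.sub hq).abs) fun x => ?_
  have := abs_sub_le (p x) (f x) (q x)
  rw [abs_sub_comm (p x) (f x)] at this
  exact this

theorem oracleError_eq_zero {Q : Set ((Fin d → ℝ) → ℝ)} {p : (Fin d → ℝ) → ℝ} (hp : p ∈ Q) :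
    oracleError Q p = 0 := by
  refine le_antisymm ?_ (Real.iInf_nonneg fun _ => l1Dist_nonneg _ _)
  refine (ciInf_le ⟨0, ?_⟩ ⟨p, hp⟩).trans_eq (by simp [l1Dist])
  rintro _ ⟨q, rfl⟩
  exact l1Dist_nonneg _ _

theorem measurableSet_unitCube : MeasurableSet (unitCube d) :=
  MeasurableSet.univ_pi fun _ => measurableSet_Ico

theorem isProbabilityMeasure_densityMeasure {p : (Fin d → ℝ) → ℝ} (hp : p ∈ cubeDensities d) :
    IsProbabilityMeasure (densityMeasure p) :=
  ⟨by rw [densityMeasure, withDensity_apply _ MeasurableSet.univ, Measure.restrict_univ,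
    hp.2.2.2]⟩

theorem densityMeasure_unitCube {p : (Fin d → ℝ) → ℝ} (hp : p ∈ cubeDensities d) :
    densityMeasure p (unitCube d) = 1 := by
  rw [densityMeasure, withDensity_apply _ measurableSet_unitCube,
    setLIntegral_eq_of_support_subset, hp.2.2.2]
  intro x hx
  by_contra h
  simp [hp.2.2.1 x h] at hx

theorem isProbabilityMeasure_sampleLaw (n : ℕ) {p : (Fin d → ℝ) → ℝ} (hp : p ∈ cubeDensities d) :
    IsProbabilityMeasure (sampleLaw n p) := by
  have := isProbabilityMeasure_densityMeasure hp
  rw [sampleLaw]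
  infer_instance

theorem ae_sampleLaw_mem_unitCube (n : ℕ) {p : (Fin d → ℝ) → ℝ} (hp : p ∈ cubeDensities d) :
    ∀ᵐ X ∂sampleLaw n p, ∀ i, X i ∈ unitCube d := by
  have := isProbabilityMeasure_densityMeasure hp
  have := isProbabilityMeasure_sampleLaw n hp
  have hs : MeasurableSet (Set.univ.pi fun _ : Fin n => unitCube d) :=
    MeasurableSet.univ_pi fun _ => measurableSet_unitCube
  have h : sampleLaw n p (Set.univ.pi fun _ => unitCube d) = 1 := by
    rw [sampleLaw, Measure.pi_pi]
    simp [densityMeasure_unitCube hp]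
  filter_upwards [(mem_ae_iff_prob_eq_one hs).2 h] with X hX i
  exact hX i (Set.mem_univ i)

theorem sampleLaw_le_smul (n c : ℕ) {p q : (Fin d → ℝ) → ℝ} (hq : q ∈ cubeDensities d)
    (h : ∀ x, p x ≤ c * q x) : sampleLaw n p ≤ (c : ENNReal) ^ n • sampleLaw n q := by
  have := isProbabilityMeasure_densityMeasure hq
  have hle : densityMeasure p ≤ (c : ENNReal) • densityMeasure q := by
    rw [densityMeasure, densityMeasure, ← withDensity_smul _ hq.1.ennreal_ofReal]
    refine withDensity_mono (ae_of_all _ fun x => ?_)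
    simp only [Pi.smul_apply, smul_eq_mul]
    rw [← ENNReal.ofReal_natCast, ← ENNReal.ofReal_mul (by positivity)]
    exact ENNReal.ofReal_le_ofReal (h x)
  have := Measure.pi_const_smul (ι := Fin n) (c : ENNReal) (ENNReal.natCast_ne_top c)
    fun _ => densityMeasure q
  rw [Fintype.card_fin] at this
  rw [sampleLaw, sampleLaw, ← this]
  exact Measure.pi_le_pi fun _ => hle

/-- The uniform distribution on the pairs `(i, σ i)`. -/
def graphWeight {m : ℕ} (σ : Fin m → Bool) (a : Fin m × Bool) : ℝ :=
  if σ a.1 = a.2 then (m : ℝ)⁻¹ else 0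

theorem graphWeight_mem_stdSimplex {m : ℕ} (hm : 0 < m) (σ : Fin m → Bool) :
    graphWeight σ ∈ stdSimplex ℝ (Fin m × Bool) := by
  refine ⟨fun a => ?_, ?_⟩
  · rw [graphWeight]
    positivity
  · have : (m : ℝ) ≠ 0 := by exact_mod_cast hm.ne'
    simp [graphWeight, Fintype.sum_prod_type, this, -Fintype.univ_bool]

theorem sum_abs_graphWeight_sub {m : ℕ} (σ τ : Fin m → Bool) :
    ∑ a, |graphWeight σ a - graphWeight τ a| = 2 * hammingDist σ τ / m := by
  have h : ∀ i, ∑ β : Bool, |graphWeight σ (i, β) - graphWeight τ (i, β)| =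
      if σ i ≠ τ i then 2 * (m : ℝ)⁻¹ else 0 := fun i => by
    simp only [graphWeight, Fintype.sum_bool]
    cases σ i <;> cases τ i <;> simp [abs_of_nonneg, two_mul]
  rw [Fintype.sum_prod_type, Finset.sum_congr rfl fun i _ => h i, ← Finset.sum_filter,
    Finset.sum_const, nsmul_eq_mul, hammingDist]
  ring

theorem uniformWeight_mem_stdSimplex {m : ℕ} (hm : 0 < m) :
    (fun _ => (2 * (m : ℝ))⁻¹) ∈ stdSimplex ℝ (Fin m × Bool) := by
  have : (m : ℝ) ≠ 0 := by exact_mod_cast hm.ne'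
  refine ⟨fun _ => by positivity, ?_⟩
  simp
  field_simp

theorem le_sampleSize_of_estimator {b n t : ℕ} (ht : 0 < t)
    {cell : Fin (16 * t) × Bool → Fin d → Fin b} (hcell : Function.Injective cell)
    {Q : Set ((Fin d → ℝ) → ℝ)} (hQ : ∀ q ∈ Q, Integrable q)
    (hQcell : ∀ w ∈ stdSimplex ℝ (Fin (16 * t) × Bool), cellMixture cell w ∈ Q)
    {V : (Fin n → Fin d → ℝ) → (Fin d → ℝ) → ℝ}
    (hV : ∀ X : Fin n → Fin d → ℝ, (∀ i, X i ∈ unitCube d) → V X ∈ Q)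
    (hP : ∀ p ∈ cubeDensities d,
      sampleLaw n p {X | l1Dist (V X) p > 3 * oracleError Q p + 1 / 16} ≤ 1 / 2) :
    10 * t ≤ n + 1 := by
  classical
  have hm : 0 < 16 * t := by positivity
  let p : (Fin (16 * t) → Bool) → (Fin d → ℝ) → ℝ := fun σ => cellMixture cell (graphWeight σ)
  let p₀ : (Fin d → ℝ) → ℝ := cellMixture cell fun _ => (2 * ((16 * t : ℕ) : ℝ))⁻¹
  have hp : ∀ σ, p σ ∈ cubeDensities d := fun σ =>
    cellMixture_mem_cubeDensities (graphWeight_mem_stdSimplex hm σ)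
  have hp₀ : p₀ ∈ cubeDensities d :=
    cellMixture_mem_cubeDensities (uniformWeight_mem_stdSimplex hm)
  have hpQ : ∀ σ, p σ ∈ Q := fun σ => hQcell _ (graphWeight_mem_stdSimplex hm σ)
  let B : (Fin (16 * t) → Bool) → Set (Fin n → Fin d → ℝ) := fun σ =>
    {X | ¬ (∀ i, X i ∈ unitCube d)} ∪ {X | l1Dist (V X) (p σ) > 1 / 16}
  -- `V` need not be measurable, so the bad event is replaced by a measurable hull of equal outer
  -- measure.
  let G : (Fin (16 * t) → Bool) → Set (Fin n → Fin d → ℝ) := fun σ =>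
    (toMeasurable (sampleLaw n (p σ)) (B σ))ᶜ
  have hGm : ∀ σ, MeasurableSet (G σ) := fun σ => (measurableSet_toMeasurable _ _).compl
  have hGmem : ∀ σ, ∀ X ∈ G σ, (∀ i, X i ∈ unitCube d) ∧ l1Dist (V X) (p σ) ≤ 1 / 16 :=
    fun σ X hX => by
      have : X ∉ B σ := fun h => hX (subset_toMeasurable _ _ h)
      simpa [B] using this
  have hG : ∀ σ, 1 / 2 ≤ sampleLaw n (p σ) (G σ) := fun σ => by
    have := isProbabilityMeasure_sampleLaw n (hp σ)
    have h1 := hP (p σ) (hp σ)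
    rw [oracleError_eq_zero (hpQ σ), mul_zero, zero_add] at h1
    have h2 : sampleLaw n (p σ) (B σ) ≤ 1 / 2 := by
      refine (measure_union_le _ _).trans ?_
      rwa [show sampleLaw n (p σ) {X | ¬ (∀ i, X i ∈ unitCube d)} = 0 from
        ae_iff.1 (ae_sampleLaw_mem_unitCube n (hp σ)), zero_add]
    rw [prob_compl_eq_one_sub (measurableSet_toMeasurable _ _), measure_toMeasurable]
    calc (1 / 2 : ENNReal) = 1 - 1 / 2 := by simp [ENNReal.one_sub_inv_two]
      _ ≤ _ := tsub_le_tsub_left h2 1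
  have hG₀ : ∀ σ, 1 / 2 ≤ 2 ^ n * sampleLaw n p₀ (G σ) := fun σ => by
    refine (hG σ).trans ?_
    have := sampleLaw_le_smul n 2 hp₀ (p := p σ) fun x => by
      rw [← cellMixture_smul]
      refine cellMixture_mono (fun a => ?_) x
      simp only [graphWeight, Pi.smul_apply, smul_eq_mul, Nat.cast_ofNat, mul_inv]
      rw [mul_inv_cancel_left₀ two_ne_zero]
      split_ifs
      · exact le_rfl
      · positivity
    simpa using this (G σ)
  -- If `X` is good for `σ` and `τ`, then `2 * hammingDist σ τ / (16 t) ≤ 1/16 + 1/16`, so the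
  -- distance is at most `t`.
  have hball : ∀ X, ((Finset.univ.filter fun σ => X ∈ G σ).card : ENNReal) ≤ 64 ^ t := fun X => by
    norm_cast
    rcases (Finset.univ.filter fun σ => X ∈ G σ).eq_empty_or_nonempty with h | ⟨σ, hσ⟩
    · simp [h]
    refine card_hammingBall_le t _ σ fun τ hτ => ?_
    obtain ⟨hX, h1⟩ := hGmem σ X (Finset.mem_filter.1 hσ).2
    obtain ⟨-, h2⟩ := hGmem τ X (Finset.mem_filter.1 hτ).2
    have h3 := l1Dist_le_add (hQ _ (hV X hX)) (hQ _ (hpQ σ)) (hQ _ (hpQ τ))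
    rw [l1Dist_cellMixture hcell, sum_abs_graphWeight_sub] at h3
    have h4 := h3.trans (add_le_add h1 h2)
    have ht' : (0 : ℝ) < t := by exact_mod_cast ht
    rw [div_le_iff₀ (by positivity)] at h4
    push_cast at h4
    have : (hammingDist σ τ : ℝ) ≤ t := by linarith
    exact_mod_cast this
  have hsum : ∑ σ, sampleLaw n p₀ (G σ) ≤ 64 ^ t := by
    have := isProbabilityMeasure_sampleLaw n hp₀
    calc ∑ σ, sampleLaw n p₀ (G σ)
        = ∫⁻ X, ∑ σ, (G σ).indicator 1 X ∂sampleLaw n p₀ := by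
          rw [lintegral_finsetSum _ fun σ _ => measurable_one.indicator (hGm σ)]
          simp [hGm]
      _ ≤ ∫⁻ _, 64 ^ t ∂sampleLaw n p₀ := by
          refine lintegral_mono fun X => ?_
          refine le_trans (le_of_eq ?_) (hball X)
          simp only [Set.indicator_apply, Pi.one_apply]
          rw [← Finset.sum_filter, Finset.sum_const, nsmul_eq_mul, mul_one]
      _ = 64 ^ t := by simp
  have hfinal : (2 : ENNReal) ^ (16 * t) * (1 / 2) ≤ 2 ^ n * 64 ^ t :=
    calc (2 : ENNReal) ^ (16 * t) * (1 / 2) = ∑ _σ : Fin (16 * t) → Bool, 1 / 2 := by simp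
      _ ≤ ∑ σ, 2 ^ n * sampleLaw n p₀ (G σ) := Finset.sum_le_sum fun σ _ => hG₀ σ
      _ ≤ 2 ^ n * 64 ^ t := by
        rw [← Finset.mul_sum]
        gcongr
  have h' : (2 : ENNReal) ^ (16 * t) ≤ 2 ^ (n + 6 * t + 1) := by
    rw [one_div, ← div_eq_mul_inv,
      ENNReal.div_le_iff_le_mul (Or.inl two_ne_zero) (Or.inl ENNReal.ofNat_ne_top)] at hfinal
    refine hfinal.trans_eq ?_
    rw [pow_succ, pow_add, pow_mul]
    norm_num
  have h'' : 2 ^ (16 * t) ≤ 2 ^ (n + 6 * t + 1) := by exact_mod_cast h'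
  have := (Nat.pow_le_pow_iff_right (by norm_num)).1 h''
  omega

theorem card_le_of_estimator {b n : ℕ} {C : Type*} [Fintype C]
    {cell : C → Fin d → Fin b} (hcell : Function.Injective cell)
    {Q : Set ((Fin d → ℝ) → ℝ)} (hQ : ∀ q ∈ Q, Integrable q)
    (hQcell : ∀ w ∈ stdSimplex ℝ C, cellMixture cell w ∈ Q)
    {V : (Fin n → Fin d → ℝ) → (Fin d → ℝ) → ℝ}
    (hV : ∀ X : Fin n → Fin d → ℝ, (∀ i, X i ∈ unitCube d) → V X ∈ Q)
    (hP : ∀ p ∈ cubeDensities d,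
      sampleLaw n p {X | l1Dist (V X) p > 3 * oracleError Q p + 1 / 16} ≤ 1 / 2) :
    Fintype.card C ≤ 32 * (n + 1) := by
  classical
  -- With `t = n + 1`, the `32 (n + 1)` cells needed would fit in `C`, giving `10 (n + 1) ≤ n + 1`.
  by_contra! hlt
  have hcard : Fintype.card (Fin (16 * (n + 1)) × Bool) ≤ Fintype.card C := by
    simp only [Fintype.card_prod, Fintype.card_fin, Fintype.card_bool]
    omega
  obtain ⟨φ⟩ := Function.Embedding.nonempty_of_card_le hcard
  have := le_sampleSize_of_estimator n.succ_pos (hcell.comp φ.injective) hQ (fun w hw => by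
    rw [cellMixture_comp]
    exact hQcell _ (sum_fiber_mem_stdSimplex φ hw)) hV hP
  omega

end LowerBound

/-! ### Two families of cells whose mixtures are Tucker histograms. -/

section Tucker

variable {d b k : ℕ}

theorem integrable_of_mem_histograms1 {f : ℝ → ℝ} (hf : f ∈ histograms1 b) : Integrable f := by
  refine convexHull_min (t := {f : ℝ → ℝ | Integrable f}) ?_ ?_ hf
  · rintro _ ⟨i, rfl⟩
    exact integrable_binDensity i
  · intro f hf g hg x y _ _ _
    exact (Integrable.smul x hf).add (Integrable.smul y hg)

theorem integrable_of_mem_tuckerHistograms {h : (Fin d → ℝ) → ℝ}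
    (hh : h ∈ tuckerHistograms d b k) : Integrable h := by
  obtain ⟨W, -, f, hf, rfl⟩ := hh
  exact integrable_finsetSum _ fun S _ =>
    (Integrable.fintype_prod fun i => integrable_of_mem_histograms1 (hf i (S i))).const_mul _

theorem binDensity_mem_histograms1 (i : Fin b) : binDensity b i ∈ histograms1 b :=
  subset_convexHull ℝ _ ⟨i, rfl⟩

theorem sum_mul_binDensity_mem_histograms1 {v : Fin b → ℝ} (hv : v ∈ stdSimplex ℝ (Fin b)) :
    (fun x => ∑ i, v i * binDensity b i x) ∈ histograms1 b := by
  have := (convex_convexHull ℝ (Set.range (binDensity b))).sum_mem (t := Finset.univ)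
    (fun i _ => hv.1 i) hv.2 fun i _ => binDensity_mem_histograms1 i
  rw [histograms1]
  convert this using 1
  funext x
  simp

/-- The cells of the grid whose indices are all less than `k`. -/
def cornerCell (hkb : k ≤ b) (S : Fin d → Fin k) (i : Fin d) : Fin b :=
  Fin.castLE hkb (S i)

theorem cornerCell_injective (hkb : k ≤ b) :
    Function.Injective (cornerCell (d := d) hkb) := fun _ _ h =>
  funext fun i => Fin.castLE_injective hkb (congrFun h i)

theorem cellMixture_cornerCell_mem (hkb : k ≤ b) {w : (Fin d → Fin k) → ℝ}
    (hw : w ∈ stdSimplex ℝ (Fin d → Fin k)) :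
    cellMixture (cornerCell hkb) w ∈ tuckerHistograms d b k :=
  ⟨w, hw, fun _ j => binDensity b (Fin.castLE hkb j), fun _ _ => binDensity_mem_histograms1 _, rfl⟩

/-- The cells with an arbitrary index `a.1` in dimension `0`, and the same index `a.2 < k` in all
the others. -/
def slabCell (hkb : k ≤ b) (a : Fin b × Fin k) (i : Fin d) : Fin b :=
  if (i : ℕ) = 0 then a.1 else Fin.castLE hkb a.2

theorem slabCell_injective (hd : 2 ≤ d) (hkb : k ≤ b) :
    Function.Injective (slabCell (d := d) hkb) := fun a a' h => by
  have h0 := congrFun h ⟨0, by omega⟩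
  have h1 := congrFun h ⟨1, by omega⟩
  simp only [slabCell, if_true, one_ne_zero, if_false] at h0 h1
  exact Prod.ext h0 (Fin.castLE_injective hkb h1)

theorem cellDensity_slabCell (hkb : k ≤ b) (a : Fin b × Fin k) (x : Fin (d + 1) → ℝ) :
    cellDensity (slabCell hkb a) x =
      binDensity b a.1 (x 0) * ∏ i : Fin d, binDensity b (Fin.castLE hkb a.2) (x i.succ) := by
  simp [cellDensity, Fin.prod_univ_succ, slabCell]

/-- Condition on the second index `j`: the tensor is diagonal with the marginal weights `r j`, and
the factor in dimension 0 is the conditional law of the first index. -/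
theorem cellMixture_slabCell_mem (hd : 0 < d) (hkb : k ≤ b) {w : Fin b × Fin k → ℝ}
    (hw : w ∈ stdSimplex ℝ (Fin b × Fin k)) :
    cellMixture (slabCell hkb) w ∈ tuckerHistograms d b k := by
  classical
  obtain ⟨d, rfl⟩ := Nat.exists_eq_succ_of_ne_zero hd.ne'
  let r : Fin k → ℝ := fun j => ∑ a, w (a, j)
  have hr : ∀ j, 0 ≤ r j := fun j => Finset.sum_nonneg fun a _ => hw.1 _
  let f₀ : Fin k → ℝ → ℝ := fun j =>
    -- When `r j = 0` any histogram serves, since it gets weight 0.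
    if r j = 0 then binDensity b (Fin.castLE hkb j)
    else fun x => ∑ a, w (a, j) / r j * binDensity b a x
  have hf₀ : ∀ j, f₀ j ∈ histograms1 b := fun j => by
    by_cases h : r j = 0
    · simp only [f₀, h, if_true]
      exact binDensity_mem_histograms1 _
    · simp only [f₀, h, if_false]
      refine sum_mul_binDensity_mem_histograms1 ⟨fun a => div_nonneg (hw.1 _) (hr j), ?_⟩
      rw [← Finset.sum_div]
      exact div_self h
  have hrf : ∀ j x, r j * f₀ j x = ∑ a, w (a, j) * binDensity b a x := fun j x => by
    by_cases h : r j = 0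
    · have h0 := (Finset.sum_eq_zero_iff_of_nonneg fun a _ => hw.1 (a, j)).1 h
      rw [h, zero_mul]
      exact (Finset.sum_eq_zero fun a ha => by rw [h0 a ha, zero_mul]).symm
    · simp only [f₀, h, if_false, Finset.mul_sum]
      exact Finset.sum_congr rfl fun a _ => by field_simp
  refine ⟨fun S => ∑ j with (fun _ => j) = S, r j, ?_,
    fun i j => if i = 0 then f₀ j else binDensity b (Fin.castLE hkb j), fun i j => ?_, ?_⟩
  · refine sum_fiber_mem_stdSimplex (fun j _ => j) ⟨hr, ?_⟩
    rw [← hw.2, Fintype.sum_prod_type_right]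
  · dsimp only
    split_ifs
    exacts [hf₀ j, binDensity_mem_histograms1 _]
  · funext x
    have hS : ∀ F : (Fin (d + 1) → Fin k) → ℝ,
        ∑ S, (∑ j with (fun _ => j) = S, r j) * F S = ∑ j, r j * F fun _ => j := fun F => by
      rw [← Finset.sum_fiberwise Finset.univ fun (j : Fin k) (_ : Fin (d + 1)) => j]
      refine Finset.sum_congr rfl fun S _ => ?_
      rw [Finset.sum_mul]
      exact Finset.sum_congr rfl fun j hj => by rw [(Finset.mem_filter.1 hj).2]
    rw [hS]
    simp only [cellMixture, cellDensity_slabCell, Fin.prod_univ_succ, if_true, Fin.succ_ne_zero,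
      if_false, ← mul_assoc, hrf, Finset.sum_mul, Fintype.sum_prod_type_right]

end Tucker

end

/-- For no sequences `b ≥ k → ∞` with `n / (b k + k ^ d) → 0` is there an estimator `V` with values
in the Tucker histograms whose error is uniformly at most three times the oracle error plus `ε`,
with probability tending to one, for every `ε > 0`. Here `V n` may be any function of the `n` sample
points; for an event that is not measurable, its probability is the outer probability. -/
theorem mainTheorem5 (d : ℕ) (hd : 2 ≤ d) (b k : ℕ → ℕ)
    (hb : Tendsto b atTop atTop) (hk : Tendsto k atTop atTop)
    (hkb : ∀ᶠ n in atTop, k n ≤ b n)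
    (hn : Tendsto (fun n : ℕ => (n : ℝ) / ((b n : ℝ) * (k n : ℝ) + (k n : ℝ) ^ d)) atTop (𝓝 0)) :
    ¬ ∃ V : (n : ℕ) → (Fin n → Fin d → ℝ) → (Fin d → ℝ) → ℝ,
      (∀ᶠ n in atTop, ∀ X : Fin n → Fin d → ℝ, (∀ i, X i ∈ unitCube d) →
        V n X ∈ tuckerHistograms d (b n) (k n)) ∧
      ∀ ε : ℝ, 0 < ε →
        Tendsto (fun n : ℕ => ⨆ p ∈ cubeDensities d,
          sampleLaw n p {X | l1Dist (V n X) p >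
            3 * oracleError (tuckerHistograms d (b n) (k n)) p + ε}) atTop (𝓝 0) := by
  rintro ⟨V, hV, hP⟩
  have hsup := (hP (1 / 16) (by norm_num)).eventually_lt_const (show (0 : ENNReal) < 1 / 2 by simp)
  have hsmall := hn.eventually_lt_const (show (0 : ℝ) < 1 / 128 by norm_num)
  obtain ⟨n, hVn, hPn, hsn, hkbn, hkn⟩ := (hV.and (hsup.and (hsmall.and (hkb.and
    (hk.eventually_ge_atTop 128))))).exists
  have hPn' : ∀ p ∈ cubeDensities d, sampleLaw n p {X | l1Dist (V n X) p >
      3 * oracleError (tuckerHistograms d (b n) (k n)) p + 1 / 16} ≤ 1 / 2 := fun p hp =>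
    (le_iSup₂ (f := fun p (_ : p ∈ cubeDensities d) => sampleLaw n p {X | l1Dist (V n X) p >
      3 * oracleError (tuckerHistograms d (b n) (k n)) p + 1 / 16}) p hp).trans hPn.le
  have h1 := card_le_of_estimator (slabCell_injective hd hkbn)
    (fun _ => integrable_of_mem_tuckerHistograms)
    (fun _ => cellMixture_slabCell_mem (by omega) hkbn) hVn hPn'
  have h2 := card_le_of_estimator (cornerCell_injective hkbn)
    (fun _ => integrable_of_mem_tuckerHistograms)
    (fun _ => cellMixture_cornerCell_mem (d := d) hkbn) hVn hPn'
  simp only [Fintype.card_prod, Fintype.card_fun, Fintype.card_fin] at h1 h2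
  have h3 : 128 * 128 ≤ b n * k n := Nat.mul_le_mul (hkn.trans hkbn) hkn
  -- From `128 * 128 ≤ b k ≤ 32 (n + 1)`; the contradiction itself only needs `64 (n + 1) ≤ 128 n`.
  have h4 : 128 ≤ n := by omega
  have h5 : (0 : ℝ) < (b n : ℝ) * k n + (k n : ℝ) ^ d := by
    have : 0 < b n * k n + k n ^ d := by omega
    exact_mod_cast this
  rw [div_lt_iff₀ h5] at hsn
  have h6 : 128 * n < b n * k n + k n ^ d := by
    have : (128 : ℝ) * n < (b n : ℝ) * k n + (k n : ℝ) ^ d := by linarith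
    exact_mod_cast this
  omega
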